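/- Let $H$ be a complex Hilbert space, with inner product $(\cdot,\cdot)$ linear in the first variable, and let $V$ be a unitary operator on $H$ which is reductive, i.e. the orthogonal complement of every closed $V$-invariant subspace of $H$ is $V$-invariant. Let $u,v\in H$ and $T=V+(\cdot,v)u$. For a positive Borel measure $\nu$ on the unit circle $\mathbb T$ let $U_\nu$ denote the operator of multiplication by the independent variable on $L^2(\nu)$. Then there exist a finite positive Borel measure $\nu$ on $\mathbb T$ (possibly zero), absolutely continuous with respect to the spectral measure of $V$ (every Borel set of spectral measure zero has $\nu$-measure zero), functions $\varphi,\psi\in L^2(\nu)$ with $\varphi\ne0$ and $\psi\ne0$ $\nu$-a.e., and unitary operators $V_1,V_2$ on complex Hilbert spaces $K_1,K_2$ (possibly zero), such that $T$ is unitarily equivalent to an operator on $K_1\oplus L^2(\nu)\oplus K_2$ of the form $$\begin{pmatrix} V_1&*&*\\ 0&T_1&*\\ 0&0&V_2\end{pmatrix},\qquad T_1=U_\nu+(\cdot,\psi)\varphi ,$$ and such that, if $T$ is invertible, then $T_1$ is invertible and $$\sup_{n\ge0}\|T^{-n}\|\le \max\Bigl(1,\ \sup_{n\ge0}\|T_1^{-n}\|\Bigr)\cdot\Bigl(2\sup_{n\ge0}\|T^n\|^2+1\Bigr),$$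 where the suprema may be $+\infty$. (If $\nu\neq0$, the term $n=0$ shows that the maximum equals $\sup_{n\ge0}\|T_1^{-n}\|$; it only matters when $\nu=0$, where $L^2(\nu)=\{0\}$.) -/

import Mathlib

open MeasureTheory InnerProductSpace
open scoped ENNReal CompactlySupported

universe w

noncomputable section

namespace RankOnePerturbation

variable {H : Type*} [NormedAddCommGroup H] [InnerProductSpace ℂ H]

/-- A bounded operator `V` on a Hilbert space is reductive if each of its closed invariant
subspaces is reducing, i.e. its orthogonal complement is invariant as well. -/
def IsReductive (V : H →L[ℂ] H) : Prop :=
  ∀ M : Submodule ℂ H, IsClosed (M : Set H) → (∀ x ∈ M, V x ∈ M) → ∀ x ∈ Mᗮ, V x ∈ Mᗮ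

/-- Unitary equivalence of operators acting on two Hilbert spaces. -/
def UnitarilyEquivalent {K : Type*} [NormedAddCommGroup K] [InnerProductSpace ℂ K]
    (T : H →L[ℂ] H) (S : K →L[ℂ] K) : Prop :=
  ∃ W : H ≃ₗᵢ[ℂ] K, ∀ x, W (T x) = S (W x)

/-! ### Borel measures on the unit circle and multiplication by the independent variable -/

/-- The unit circle `𝕋` in the complex plane, with its usual topology and Borel σ-algebra. -/
abbrev UnitCircle : Type := Metric.sphere (0 : ℂ) 1

theorem memLp_coe_mul {ν : Measure UnitCircle} (f : Lp ℂ 2 ν) :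
    MemLp (fun z : UnitCircle => (z : ℂ) * f z) 2 ν :=
  (Lp.memLp f).of_le
    ((measurable_subtype_coe.aestronglyMeasurable).mul (Lp.memLp f).1)
    (Filter.Eventually.of_forall fun z => by rw [norm_mul, norm_eq_of_mem_sphere, one_mul])

/-- The operator `U_ν` of multiplication by the independent variable in `L²(ν)`. -/
def mulVar (ν : Measure UnitCircle) : Lp ℂ 2 ν →L[ℂ] Lp ℂ 2 ν :=
  LinearMap.mkContinuous
    { toFun := fun f => (memLp_coe_mul f).toLp
      map_add' := fun f g => by
        rw [← MemLp.toLp_add]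
        refine MemLp.toLp_congr _ _ ?_
        filter_upwards [Lp.coeFn_add f g] with z hz
        simp only [hz, Pi.add_apply, mul_add]
      map_smul' := fun c f => by
        rw [← MemLp.toLp_const_smul]
        refine MemLp.toLp_congr _ _ ?_
        filter_upwards [Lp.coeFn_smul c f] with z hz
        simp [hz, mul_left_comm] }
    1 fun f => by
      rw [one_mul]
      refine Lp.norm_le_norm_of_ae_le ?_
      filter_upwards [MemLp.coeFn_toLp (memLp_coe_mul f)] with z hz
      simp only [LinearMap.coe_mk, AddHom.coe_mk]
      rw [hz, norm_mul, norm_eq_of_mem_sphere, one_mul]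

theorem coeFn_mulVar (ν : Measure UnitCircle) (f : Lp ℂ 2 ν) :
    mulVar ν f =ᵐ[ν] fun z => (z : ℂ) * f z :=
  MemLp.coeFn_toLp (memLp_coe_mul f)

/-! ### The spectral measure of a unitary operator -/

section SpectralMeasure

variable [CompleteSpace H]

/-- The inclusion of the spectrum of a unitary operator into the unit circle. -/
def spectrumToCircle (V : unitary (H →L[ℂ] H)) :
    C(spectrum ℂ (V : H →L[ℂ] H), UnitCircle) where
  toFun z := ⟨z.1, spectrum.subset_circle_of_unitary V.2 z.2⟩
  continuous_toFun := by fun_prop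

/-- A real continuous function on the unit circle, restricted to the spectrum of a unitary
operator and regarded as a complex-valued function there. -/
def restrictToSpectrum (V : unitary (H →L[ℂ] H)) (f : C_c(UnitCircle, ℝ)) :
    C(spectrum ℂ (V : H →L[ℂ] H), ℂ) where
  toFun z := (f (spectrumToCircle V z) : ℂ)
  continuous_toFun := by fun_prop

/-- The operator `f(V)` for a unitary operator `V` and a real continuous function `f` on the
unit circle (continuous functional calculus). -/
def applyFun (V : unitary (H →L[ℂ] H)) (f : C_c(UnitCircle, ℝ)) : H →L[ℂ] H :=
  cfcHom (R := ℂ) (a := (V : H →L[ℂ] H)) (p := IsStarNormal) inferInstance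
    (restrictToSpectrum V f)

theorem applyFun_add (V : unitary (H →L[ℂ] H)) (f g : C_c(UnitCircle, ℝ)) :
    applyFun V (f + g) = applyFun V f + applyFun V g := by
  unfold applyFun
  rw [← map_add]
  congr 1
  ext z
  simp [restrictToSpectrum]

theorem applyFun_smul (V : unitary (H →L[ℂ] H)) (c : ℝ) (f : C_c(UnitCircle, ℝ)) :
    applyFun V (c • f) = (c : ℂ) • applyFun V f := by
  unfold applyFun
  rw [← map_smul]
  congr 1
  ext z
  simp [restrictToSpectrum]

open scoped ComplexOrder in
theorem applyFun_nonneg (V : unitary (H →L[ℂ] H)) {f : C_c(UnitCircle, ℝ)} (hf : 0 ≤ f) (x : H) :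
    0 ≤ (inner ℂ x (applyFun V f x)).re := by
  have h : 0 ≤ applyFun V f := by
    unfold applyFun
    rw [cfcHom_nonneg_iff]
    intro z
    have := hf (spectrumToCircle V z)
    simpa [restrictToSpectrum] using Complex.zero_le_real.2 this
  exact ((ContinuousLinearMap.nonneg_iff_isPositive _).1 h).re_inner_nonneg_right x

/-- The positive functional `f ↦ (f(V) x, x)` on the real continuous functions on the circle. -/
def spectralFunctional (V : unitary (H →L[ℂ] H)) (x : H) : C_c(UnitCircle, ℝ) →ₚ[ℝ] ℝ :=
  PositiveLinearMap.mk₀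
    { toFun := fun f => (inner ℂ x (applyFun V f x)).re
      map_add' := fun f g => by simp [applyFun_add]
      map_smul' := fun c f => by simp [applyFun_smul] }
    fun _ hf => applyFun_nonneg V hf x

/-- The scalar measure `B ↦ (E(B) x, x)`, where `E` is the (projection-valued) spectral measure of
the unitary operator `V`: it is the unique regular Borel measure `μ` on the unit circle such that
`∫ f dμ = (f(V) x, x)` for each continuous `f`. -/
def spectralMeasureAt (V : unitary (H →L[ℂ] H)) (x : H) : Measure UnitCircle :=
  RealRMK.rieszMeasure (spectralFunctional V x)

/-- `ν` is absolutely continuous with respect to the spectral measure `E` of `V`: `E(B) = 0`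
implies `ν(B) = 0` for Borel sets `B`. As `E(B)` is a projection, `E(B) = 0` means that
`(E(B) x, x) = 0` for all `x`. -/
def AbsolutelyContinuousSpectral (ν : Measure UnitCircle) (V : unitary (H →L[ℂ] H)) : Prop :=
  ∀ B : Set UnitCircle, MeasurableSet B → (∀ x : H, spectralMeasureAt V x B = 0) → ν B = 0

end SpectralMeasure

/-! ### Upper-triangular block operators -/

section Block

variable {K₁ K₂ K₃ : Type*}
  [NormedAddCommGroup K₁] [InnerProductSpace ℂ K₁]
  [NormedAddCommGroup K₂] [InnerProductSpace ℂ K₂]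
  [NormedAddCommGroup K₃] [InnerProductSpace ℂ K₃]

/-- The operator on the Hilbert space `K₁ ⊕ K₂ ⊕ K₃` with the matrix
`(A₁₁ A₁₂ A₁₃; 0 A₂₂ A₂₃; 0 0 A₃₃)`. -/
def upperTriangular (A₁₁ : K₁ →L[ℂ] K₁) (A₁₂ : K₂ →L[ℂ] K₁) (A₁₃ : K₃ →L[ℂ] K₁)
    (A₂₂ : K₂ →L[ℂ] K₂) (A₂₃ : K₃ →L[ℂ] K₂) (A₃₃ : K₃ →L[ℂ] K₃) :
    WithLp 2 (K₁ × WithLp 2 (K₂ × K₃)) →L[ℂ] WithLp 2 (K₁ × WithLp 2 (K₂ × K₃)) :=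
  let p₁ : WithLp 2 (K₁ × WithLp 2 (K₂ × K₃)) →L[ℂ] K₁ := WithLp.fstL 2 ℂ _ _
  let p₂ : WithLp 2 (K₁ × WithLp 2 (K₂ × K₃)) →L[ℂ] K₂ :=
    WithLp.fstL 2 ℂ _ _ ∘L WithLp.sndL 2 ℂ _ _
  let p₃ : WithLp 2 (K₁ × WithLp 2 (K₂ × K₃)) →L[ℂ] K₃ :=
    WithLp.sndL 2 ℂ _ _ ∘L WithLp.sndL 2 ℂ _ _
  (WithLp.prodContinuousLinearEquiv 2 ℂ K₁ (WithLp 2 (K₂ × K₃))).symm.toContinuousLinearMap ∘L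
    (A₁₁ ∘L p₁ + A₁₂ ∘L p₂ + A₁₃ ∘L p₃).prod
      ((WithLp.prodContinuousLinearEquiv 2 ℂ K₂ K₃).symm.toContinuousLinearMap ∘L
        (A₂₂ ∘L p₂ + A₂₃ ∘L p₃).prod (A₃₃ ∘L p₃))

theorem upperTriangular_apply (A₁₁ : K₁ →L[ℂ] K₁) (A₁₂ : K₂ →L[ℂ] K₁) (A₁₃ : K₃ →L[ℂ] K₁)
    (A₂₂ : K₂ →L[ℂ] K₂) (A₂₃ : K₃ →L[ℂ] K₂) (A₃₃ : K₃ →L[ℂ] K₃)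
    (x₁ : K₁) (x₂ : K₂) (x₃ : K₃) :
    upperTriangular A₁₁ A₁₂ A₁₃ A₂₂ A₂₃ A₃₃ (WithLp.toLp 2 (x₁, WithLp.toLp 2 (x₂, x₃))) =
      WithLp.toLp 2 (A₁₁ x₁ + A₁₂ x₂ + A₁₃ x₃,
        WithLp.toLp 2 (A₂₂ x₂ + A₂₃ x₃, A₃₃ x₃)) := rfl

end Block

end RankOnePerturbation

end

open RankOnePerturbation

noncomputable section

/-! Let `μ` be the spectral measure of `V` at `v`. The map `f ↦ f(V) v` is an isometry `J` of
`L²(μ)` into `H` which turns multiplication by the variable into `V`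
(`exists_isometry_spectralMeasureAt`). Let `N` be its range, put `g = J* u` and `s = {g ≠ 0}`, and
split `N` into the functions living on `s` and those living off `s`. By reductivity `V` restricts to
a unitary on `Nᗮ` and on the part of `N` off `s`. Since `v ∈ N`, the functional `(·, v)` vanishes on
`Nᗮ`; since `g` vanishes off `s`, the vector `u` has no component in the last summand. So the
rank-one term has neither a first column nor a third row, which is the triangular form
(`exists_unitarilyEquivalent_upperTriangular`) with `ν = μ|_s`, `φ = g|_s`, `ψ = 1|_s`.

For the inverse bound, `T ^ n` is again triangular with unitary corners and middle entry `T₁ ^ n`. A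
bound `c` on its norm controls the entries sharing a row or column with a unitary corner, and back
substitution then bounds `T ^ n` below in terms of `T₁ ^ n` (`norm_le_of_norm_upperTriangular_le`).
-/

namespace RankOnePerturbation

/-! ### Triangular block operators with unitary corners -/

section BlockEstimates

set_option linter.unusedSectionVars false

variable {K₁ K₂ K₃ : Type*}
  [NormedAddCommGroup K₁] [InnerProductSpace ℂ K₁]
  [NormedAddCommGroup K₂] [InnerProductSpace ℂ K₂]
  [NormedAddCommGroup K₃] [InnerProductSpace ℂ K₃]

/-- The vector of `K₁ ⊕ K₂ ⊕ K₃` with the given components. -/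
def triple (x₁ : K₁) (x₂ : K₂) (x₃ : K₃) : WithLp 2 (K₁ × WithLp 2 (K₂ × K₃)) :=
  WithLp.toLp 2 (x₁, WithLp.toLp 2 (x₂, x₃))

theorem exists_eq_triple (x : WithLp 2 (K₁ × WithLp 2 (K₂ × K₃))) :
    ∃ x₁ x₂ x₃, x = triple x₁ x₂ x₃ :=
  ⟨x.fst, x.snd.fst, x.snd.snd, rfl⟩

theorem triple_inj {x₁ y₁ : K₁} {x₂ y₂ : K₂} {x₃ y₃ : K₃} :
    triple x₁ x₂ x₃ = triple y₁ y₂ y₃ ↔ x₁ = y₁ ∧ x₂ = y₂ ∧ x₃ = y₃ := by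
  refine ⟨fun h => ⟨?_, ?_, ?_⟩, ?_⟩
  · simpa [triple] using congrArg (fun x => x.fst) h
  · simpa [triple] using congrArg (fun x => x.snd.fst) h
  · simpa [triple] using congrArg (fun x => x.snd.snd) h
  · rintro ⟨rfl, rfl, rfl⟩; rfl

theorem triple_add (x₁ y₁ : K₁) (x₂ y₂ : K₂) (x₃ y₃ : K₃) :
    triple x₁ x₂ x₃ + triple y₁ y₂ y₃ = triple (x₁ + y₁) (x₂ + y₂) (x₃ + y₃) := rfl

theorem norm_triple_sq (x₁ : K₁) (x₂ : K₂) (x₃ : K₃) :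
    ‖triple x₁ x₂ x₃‖ ^ 2 = ‖x₁‖ ^ 2 + ‖x₂‖ ^ 2 + ‖x₃‖ ^ 2 := by
  simp [triple, WithLp.prod_norm_sq_eq_of_L2, add_assoc]

theorem upperTriangular_triple (A₁₁ : K₁ →L[ℂ] K₁) (A₁₂ : K₂ →L[ℂ] K₁) (A₁₃ : K₃ →L[ℂ] K₁)
    (A₂₂ : K₂ →L[ℂ] K₂) (A₂₃ : K₃ →L[ℂ] K₂) (A₃₃ : K₃ →L[ℂ] K₃)
    (x₁ : K₁) (x₂ : K₂) (x₃ : K₃) :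
    upperTriangular A₁₁ A₁₂ A₁₃ A₂₂ A₂₃ A₃₃ (triple x₁ x₂ x₃) =
      triple (A₁₁ x₁ + A₁₂ x₂ + A₁₃ x₃) (A₂₂ x₂ + A₂₃ x₃) (A₃₃ x₃) := rfl

theorem exists_upperTriangular_pow (A₁₁ : K₁ →L[ℂ] K₁) (A₁₂ : K₂ →L[ℂ] K₁)
    (A₁₃ : K₃ →L[ℂ] K₁) (A₂₂ : K₂ →L[ℂ] K₂) (A₂₃ : K₃ →L[ℂ] K₂) (A₃₃ : K₃ →L[ℂ] K₃) (n : ℕ) :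
    ∃ A B C, upperTriangular A₁₁ A₁₂ A₁₃ A₂₂ A₂₃ A₃₃ ^ n =
      upperTriangular (A₁₁ ^ n) A B (A₂₂ ^ n) C (A₃₃ ^ n) := by
  induction n with
  | zero =>
    refine ⟨0, 0, 0, ?_⟩
    ext1 x
    obtain ⟨x₁, x₂, x₃, rfl⟩ := exists_eq_triple x
    simp [upperTriangular_triple]
  | succ n ih =>
    obtain ⟨A, B, C, h⟩ := ih
    refine ⟨(A₁₁ ^ n) ∘L A₁₂ + A ∘L A₂₂, (A₁₁ ^ n) ∘L A₁₃ + A ∘L A₂₃ + B ∘L A₃₃,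
      (A₂₂ ^ n) ∘L A₂₃ + C ∘L A₃₃, ?_⟩
    ext1 x
    obtain ⟨x₁, x₂, x₃, rfl⟩ := exists_eq_triple x
    rw [pow_succ, h, mul_apply_eq_comp, upperTriangular_triple,
      upperTriangular_triple, upperTriangular_triple, triple_inj]
    simp only [pow_succ, mul_apply_eq_comp, map_add, add_apply,
      ContinuousLinearMap.comp_apply]
    exact ⟨by abel, by abel, trivial⟩

theorem bijective_middle_of_bijective_upperTriangular
    {V₁ : K₁ ≃ₗᵢ[ℂ] K₁} {V₃ : K₃ ≃ₗᵢ[ℂ] K₃} {A : K₂ →L[ℂ] K₁} {B : K₃ →L[ℂ] K₁}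
    {R : K₂ →L[ℂ] K₂} {C : K₃ →L[ℂ] K₂}
    (h : Function.Bijective (upperTriangular (V₁ : K₁ →L[ℂ] K₁) A B R C (V₃ : K₃ →L[ℂ] K₃))) :
    Function.Bijective R := by
  constructor
  · rw [injective_iff_map_eq_zero]
    intro b hb
    -- The first entry is chosen to cancel `A b`, so a kernel vector of `R` lifts to one of the
    -- block operator.
    have h0 : triple (-V₁.symm (A b)) b (0 : K₃) = triple 0 0 0 :=
      h.1 (by rw [upperTriangular_triple, upperTriangular_triple]; simp [hb])
    exact (triple_inj.1 h0).2.1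
  · intro b
    obtain ⟨y, hy⟩ := h.2 (triple 0 b 0)
    obtain ⟨y₁, y₂, y₃, rfl⟩ := exists_eq_triple y
    rw [upperTriangular_triple, triple_inj] at hy
    have h3 : y₃ = 0 := by simpa using hy.2.2
    exact ⟨y₂, by simpa [h3] using hy.2.1⟩

/-- A bounded block row `(V A)` of norm at most `c` with `V` unitary has `‖A‖² ≤ c² - 1`. -/
theorem norm_sq_le_of_norm_upperTriangular_le
    {V₁ : K₁ ≃ₗᵢ[ℂ] K₁} {A₃₃ : K₃ →L[ℂ] K₃} {A : K₂ →L[ℂ] K₁} {B : K₃ →L[ℂ] K₁}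
    {R : K₂ →L[ℂ] K₂} {C : K₃ →L[ℂ] K₂} {c : ℝ} (hc : 1 ≤ c)
    (hS : ∀ z, ‖upperTriangular (V₁ : K₁ →L[ℂ] K₁) A B R C A₃₃ z‖ ≤ c * ‖z‖) (b : K₂) :
    ‖A b‖ ^ 2 ≤ (c ^ 2 - 1) * ‖b‖ ^ 2 := by
  -- Test on `(t V₁⁻¹ A b, b, 0)`, whose image has first entry `(t + 1) A b`. The resulting
  -- quadratic in `t` is nonnegative, and its discriminant yields the bound.
  have key : ∀ t : ℝ, 0 ≤ (c ^ 2 - 1) * ‖A b‖ ^ 2 * (t * t) + (-2 * ‖A b‖ ^ 2) * t +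
      (c ^ 2 * ‖b‖ ^ 2 - ‖A b‖ ^ 2) := by
    intro t
    have h := hS (triple ((t : ℂ) • V₁.symm (A b)) b 0)
    have h2 := pow_le_pow_left₀ (norm_nonneg _) h 2
    have e : (t : ℂ) • A b + A b = ((t + 1 : ℝ) : ℂ) • A b := by
      push_cast; rw [add_smul, one_smul]
    rw [mul_pow, upperTriangular_triple, norm_triple_sq, norm_triple_sq] at h2
    simp only [map_smul, LinearIsometryEquiv.coe_coe'', LinearIsometryEquiv.apply_symm_apply,
      map_zero, add_zero, norm_zero, e, norm_smul, LinearIsometryEquiv.norm_map,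
      Complex.norm_real, Real.norm_eq_abs, mul_pow, sq_abs] at h2
    nlinarith [sq_nonneg ‖R b‖]
  have hd := discrim_le_zero key
  rw [discrim] at hd
  have hc2 : 1 ≤ c ^ 2 := one_le_pow₀ hc
  rcases (norm_nonneg (A b)).eq_or_lt with h0 | h0
  · rw [← h0]
    simpa using mul_nonneg (sub_nonneg.2 hc2) (sq_nonneg ‖b‖)
  · have hq : 0 < ‖A b‖ ^ 2 := by positivity
    have h1 : ‖A b‖ ^ 2 * ‖A b‖ ^ 2 ≤
        ‖A b‖ ^ 2 * ((c ^ 2 - 1) * (c ^ 2 * ‖b‖ ^ 2 - ‖A b‖ ^ 2)) := by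
      linarith
    have h2 := le_of_mul_le_mul_left h1 hq
    have h3 : c ^ 2 * ‖A b‖ ^ 2 ≤ c ^ 2 * ((c ^ 2 - 1) * ‖b‖ ^ 2) := by linarith
    exact le_of_mul_le_mul_left h3 (by linarith)

/-- A bounded block upper-triangular operator with unitary corners is bounded below as soon as its
middle entry is. -/
theorem norm_le_of_norm_upperTriangular_le
    {V₁ : K₁ ≃ₗᵢ[ℂ] K₁} {V₃ : K₃ ≃ₗᵢ[ℂ] K₃} {A : K₂ →L[ℂ] K₁} {B : K₃ →L[ℂ] K₁}
    {R : K₂ →L[ℂ] K₂} {C : K₃ →L[ℂ] K₂} {c s : ℝ} (hc : 1 ≤ c) (hs : 1 ≤ s)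
    (hS : ∀ z, ‖upperTriangular (V₁ : K₁ →L[ℂ] K₁) A B R C (V₃ : K₃ →L[ℂ] K₃) z‖ ≤ c * ‖z‖)
    (hR : ∀ b, ‖b‖ ≤ s * ‖R b‖) (y : WithLp 2 (K₁ × WithLp 2 (K₂ × K₃))) :
    ‖y‖ ≤ s * (2 * c ^ 2 + 1) *
      ‖upperTriangular (V₁ : K₁ →L[ℂ] K₁) A B R C (V₃ : K₃ →L[ℂ] K₃) y‖ := by
  obtain ⟨y₁, y₂, y₃, rfl⟩ := exists_eq_triple y
  have hc2 : 1 ≤ c ^ 2 := one_le_pow₀ hc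
  have hA := norm_sq_le_of_norm_upperTriangular_le hc hS y₂
  have hB : ‖B y₃‖ ≤ c * ‖y₃‖ ∧ ‖C y₃‖ ^ 2 ≤ (c ^ 2 - 1) * ‖y₃‖ ^ 2 := by
    have h := pow_le_pow_left₀ (norm_nonneg _) (hS (triple 0 0 y₃)) 2
    rw [upperTriangular_triple, mul_pow, norm_triple_sq, norm_triple_sq] at h
    simp only [map_zero, zero_add, LinearIsometryEquiv.coe_coe'', LinearIsometryEquiv.norm_map,
      norm_zero] at h
    refine ⟨abs_le_of_sq_le_sq' ?_ (by positivity) |>.2, ?_⟩ <;>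
    nlinarith [sq_nonneg ‖B y₃‖, sq_nonneg ‖C y₃‖, sq_nonneg ‖y₃‖]
  obtain ⟨hB, hC⟩ := hB
  rw [upperTriangular_triple]
  set x₁ := (V₁ : K₁ →L[ℂ] K₁) y₁ + A y₂ + B y₃ with hx₁
  set x₂ := R y₂ + C y₃ with hx₂
  have hx₃ : ‖(V₃ : K₃ →L[ℂ] K₃) y₃‖ = ‖y₃‖ := V₃.norm_map y₃
  have hN := norm_triple_sq x₁ x₂ ((V₃ : K₃ →L[ℂ] K₃) y₃)
  rw [hx₃] at hN
  set N := ‖triple x₁ x₂ ((V₃ : K₃ →L[ℂ] K₃) y₃)‖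
  have hN0 : 0 ≤ N := norm_nonneg _
  -- Back substitution: solve the first row for `y₁` and group the terms by what controls them,
  -- namely `y₂`, the image, and `B y₃`.
  have hsplit : triple y₁ y₂ y₃ = triple (-V₁.symm (A y₂)) y₂ 0 +
      (triple (V₁.symm x₁) 0 y₃ + triple (-V₁.symm (B y₃)) 0 0) := by
    rw [triple_add, triple_add, triple_inj]
    refine ⟨?_, by simp, by simp⟩
    simp only [hx₁, map_add, LinearIsometryEquiv.coe_coe'', LinearIsometryEquiv.symm_apply_apply]
    abel
  have h1 : ‖triple (-V₁.symm (A y₂)) y₂ (0 : K₃)‖ ≤ c * ‖y₂‖ := by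
    refine abs_le_of_sq_le_sq' ?_ (by positivity) |>.2
    rw [norm_triple_sq, norm_neg, LinearIsometryEquiv.norm_map, norm_zero, mul_pow]
    linarith
  have h2 : ‖triple (V₁.symm x₁) (0 : K₂) y₃‖ ≤ N := by
    refine abs_le_of_sq_le_sq' ?_ hN0 |>.2
    rw [norm_triple_sq, LinearIsometryEquiv.norm_map, norm_zero, hN]
    nlinarith [sq_nonneg ‖x₂‖]
  have h3 : ‖triple (-V₁.symm (B y₃)) (0 : K₂) (0 : K₃)‖ ≤ c * N := by
    refine abs_le_of_sq_le_sq' ?_ (by positivity) |>.2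
    rw [norm_triple_sq, norm_neg, LinearIsometryEquiv.norm_map, norm_zero, norm_zero, mul_pow, hN]
    have := pow_le_pow_left₀ (norm_nonneg _) hB 2
    rw [mul_pow] at this
    nlinarith [mul_nonneg (sq_nonneg c) (sq_nonneg ‖x₁‖),
      mul_nonneg (sq_nonneg c) (sq_nonneg ‖x₂‖)]
  have h4 : ‖R y₂‖ ≤ c * N := by
    have e : R y₂ = x₂ - C y₃ := by simp [hx₂]
    have ht : ‖R y₂‖ ≤ ‖x₂‖ + ‖C y₃‖ := e ▸ norm_sub_le _ _
    refine ht.trans (abs_le_of_sq_le_sq' ?_ (by positivity) |>.2)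
    rw [mul_pow, hN]
    -- Cauchy–Schwarz with weights `1` and `√(c² - 1)`, avoiding the root: `(‖x₂‖ + ‖C y₃‖)² ≤ c²
    -- (‖x₂‖² + ‖y₃‖²)`.
    have h5 : (‖x₂‖ * ‖C y₃‖) ^ 2 ≤ ((c ^ 2 - 1) * ‖x₂‖ ^ 2) * ‖y₃‖ ^ 2 := by
      rw [mul_pow]
      nlinarith [sq_nonneg ‖x₂‖]
    have h6 : 2 * (‖x₂‖ * ‖C y₃‖) ≤ (c ^ 2 - 1) * ‖x₂‖ ^ 2 + ‖y₃‖ ^ 2 := by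
      have hp : 0 ≤ (c ^ 2 - 1) * ‖x₂‖ ^ 2 := mul_nonneg (by linarith) (sq_nonneg _)
      refine abs_le_of_sq_le_sq' ?_ (by positivity) |>.2
      nlinarith [sq_nonneg ((c ^ 2 - 1) * ‖x₂‖ ^ 2 - ‖y₃‖ ^ 2)]
    nlinarith [mul_nonneg (sq_nonneg c) (sq_nonneg ‖x₁‖)]
  have h7 : ‖y₂‖ ≤ s * (c * N) := (hR y₂).trans (by gcongr)
  calc ‖triple y₁ y₂ y₃‖ ≤ c * ‖y₂‖ + (N + c * N) := by
        rw [hsplit]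
        exact (norm_add_le _ _).trans (add_le_add h1 ((norm_add_le _ _).trans (add_le_add h2 h3)))
    _ ≤ c * (s * (c * N)) + (N + c * N) := by gcongr
    _ = (s * c ^ 2 + (1 + c)) * N := by ring
    -- Here `c ≤ c²` and `1 ≤ s` are used.
    _ ≤ (s * c ^ 2 + s * (1 + c ^ 2)) * N := by
        gcongr
        nlinarith
    _ = s * (2 * c ^ 2 + 1) * N := by ring

end BlockEstimates

/-! ### The cyclic model of a unitary operator -/

section SpectralRepresentation

variable {H : Type*} [NormedAddCommGroup H] [InnerProductSpace ℂ H] [CompleteSpace H]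

/-- The continuous functional calculus of a unitary operator for continuous functions on the
whole circle. -/
def circleCalculus (V : unitary (H →L[ℂ] H)) : C(UnitCircle, ℂ) →⋆ₐ[ℂ] (H →L[ℂ] H) :=
  (cfcHom (R := ℂ) (a := (V : H →L[ℂ] H)) (p := IsStarNormal) inferInstance).comp
    (ContinuousMap.compStarAlgHom' ℂ ℂ (spectrumToCircle V))

/-- The independent variable, as a continuous function on the circle. -/
def circleVar : C(UnitCircle, ℂ) := ⟨fun z => (z : ℂ), continuous_subtype_val⟩

theorem circleCalculus_circleVar (V : unitary (H →L[ℂ] H)) :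
    circleCalculus V circleVar = (V : H →L[ℂ] H) := by
  have : (ContinuousMap.compStarAlgHom' ℂ ℂ (spectrumToCircle V)) circleVar =
      (ContinuousMap.id ℂ).restrict (spectrum ℂ (V : H →L[ℂ] H)) := rfl
  rw [circleCalculus, StarAlgHom.comp_apply, this, cfcHom_id]

/-- The squared absolute value of a continuous function on the circle. -/
def normSqFun (f : C(UnitCircle, ℂ)) : C_c(UnitCircle, ℝ) where
  toFun z := ‖f z‖ ^ 2
  continuous_toFun := by fun_prop
  hasCompactSupport' := HasCompactSupport.of_compactSpace _

theorem applyFun_normSqFun (V : unitary (H →L[ℂ] H)) (f : C(UnitCircle, ℂ)) :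
    applyFun V (normSqFun f) = star (circleCalculus V f) * circleCalculus V f := by
  rw [← map_star, ← map_mul]
  unfold applyFun circleCalculus
  rw [StarAlgHom.comp_apply]
  congr 1
  ext z
  simp only [restrictToSpectrum, normSqFun, ContinuousMap.coe_mk,
    CompactlySupportedContinuousMap.coe_mk, ContinuousMap.compStarAlgHom'_apply,
    ContinuousMap.comp_apply, ContinuousMap.mul_apply, ContinuousMap.star_apply]
  rw [RCLike.star_def, RCLike.conj_mul]
  simp

instance (V : unitary (H →L[ℂ] H)) (x : H) : IsFiniteMeasure (spectralMeasureAt V x) := by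
  unfold spectralMeasureAt; infer_instance

instance (V : unitary (H →L[ℂ] H)) (x : H) : (spectralMeasureAt V x).Regular := by
  unfold spectralMeasureAt; infer_instance

/-- Both squares equal `∫ |f|² dμ`, because `f(V)* f(V) = |f|²(V)`. Passing to `|f|²` is needed
since the measure represents a functional on real functions. -/
theorem norm_circleCalculus_apply (V : unitary (H →L[ℂ] H)) (x : H) (f : C(UnitCircle, ℂ)) :
    ‖circleCalculus V f x‖ = ‖ContinuousMap.toLp 2 (spectralMeasureAt V x) ℂ f‖ := by
  rw [← sq_eq_sq₀ (norm_nonneg _) (norm_nonneg _)]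
  have h1 : ∫ z, normSqFun f z ∂(spectralMeasureAt V x) = spectralFunctional V x (normSqFun f) :=
    RealRMK.integral_rieszMeasure _ _
  have h2 : spectralFunctional V x (normSqFun f) = (inner ℂ x (applyFun V (normSqFun f) x)).re :=
    rfl
  have h3 := inner_self_eq_norm_sq_to_K (𝕜 := ℂ) (ContinuousMap.toLp 2 (spectralMeasureAt V x) ℂ f)
  rw [ContinuousMap.inner_toLp] at h3
  have h4 : (fun z => f z * (starRingEnd ℂ) (f z)) = fun z => ((normSqFun f z : ℝ) : ℂ) := by
    ext z
    rw [RCLike.mul_conj]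
    simp [normSqFun]
  rw [h4, integral_complex_ofReal, h1, h2, applyFun_normSqFun, mul_apply_eq_comp,
    ContinuousLinearMap.star_eq_adjoint, ContinuousLinearMap.adjoint_inner_right,
    inner_self_eq_norm_sq_to_K] at h3
  have h5 := congrArg Complex.re h3
  simpa [← Complex.ofReal_pow] using h5

/-- The isometry `f ↦ f(V) x` of `L²(μ)` into `H`, where `μ` is the spectral measure of `V`
at `x`. -/
theorem exists_isometry_spectralMeasureAt (V : unitary (H →L[ℂ] H)) (x : H) :
    ∃ J : Lp ℂ 2 (spectralMeasureAt V x) →ₗᵢ[ℂ] H,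
      (∀ f, J (mulVar _ f) = (V : H →L[ℂ] H) (J f)) ∧
      J (ContinuousMap.toLp 2 (spectralMeasureAt V x) ℂ 1) = x := by
  set μ := spectralMeasureAt V x with hμ
  let e : C(UnitCircle, ℂ) →ₗ[ℂ] Lp ℂ 2 μ := (ContinuousMap.toLp 2 μ ℂ : _ →L[ℂ] _).toLinearMap
  let F : C(UnitCircle, ℂ) →ₗ[ℂ] H :=
    { toFun := fun f => circleCalculus V f x
      map_add' := fun f g => by simp
      map_smul' := fun c f => by simp }
  -- Continuous functions are dense in `L²(μ)`, so `f ↦ f(V) x` extends from them, and the isometry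
  -- and intertwining identities pass to the limit.
  have hd : DenseRange e := ContinuousMap.toLp_denseRange ℂ μ ℂ (by norm_num)
  have hn : ∀ f, ‖F f‖ ≤ 1 * ‖e f‖ := fun f => by
    rw [one_mul]; exact (norm_circleCalculus_apply V x f).le
  have hJ : ∀ f, F.extendOfNorm e (e f) = F f := LinearMap.extendOfNorm_eq hd ⟨1, hn⟩
  have hnorm : ∀ f, ‖F.extendOfNorm e f‖ = ‖f‖ := by
    intro f
    induction f using hd.induction_on with
    | hp => exact isClosed_eq (by fun_prop) (by fun_prop)
    | ih f => rw [hJ]; exact norm_circleCalculus_apply V x f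
  refine ⟨⟨(F.extendOfNorm e).toLinearMap, hnorm⟩, ?_, ?_⟩
  · intro f
    change F.extendOfNorm e (mulVar _ f) = (V : H →L[ℂ] H) (F.extendOfNorm e f)
    induction f using hd.induction_on with
    | hp => exact isClosed_eq (by fun_prop) (by fun_prop)
    | ih f =>
      have : mulVar μ (e f) = e (circleVar * f) := by
        refine Lp.ext ?_
        filter_upwards [coeFn_mulVar μ (e f), ContinuousMap.coeFn_toLp (p := 2) (𝕜 := ℂ) μ f,
          ContinuousMap.coeFn_toLp (p := 2) (𝕜 := ℂ) μ (circleVar * f)] with z h1 h2 h3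
        rw [h1]
        change (z : ℂ) * (ContinuousMap.toLp 2 μ ℂ f) z =
          (ContinuousMap.toLp 2 μ ℂ (circleVar * f)) z
        rw [h2, h3]; rfl
      rw [this, hJ, hJ]
      change circleCalculus V (circleVar * f) x = (V : H →L[ℂ] H) (circleCalculus V f x)
      rw [map_mul, circleCalculus_circleVar]; rfl
  · change F.extendOfNorm e (e 1) = x
    rw [hJ]
    change circleCalculus V 1 x = x
    rw [map_one]; rfl

theorem memLp_indicator_coeFn {α : Type*} [MeasurableSpace α] {μ : Measure α} {s : Set α}
    (hs : MeasurableSet s) (f : Lp ℂ 2 (μ.restrict s)) : MemLp (s.indicator f) 2 μ :=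
  (memLp_indicator_iff_restrict hs).2 (Lp.memLp f)

theorem norm_toLp_indicator {α : Type*} [MeasurableSpace α] {μ : Measure α} {s : Set α}
    (hs : MeasurableSet s) (f : Lp ℂ 2 (μ.restrict s)) :
    ‖(memLp_indicator_coeFn hs f).toLp‖ = ‖f‖ := by
  have h := eLpNorm_indicator_eq_eLpNorm_restrict (μ := μ) (p := 2) (f := f) hs
  have h' := Lp.norm_toLp (s.indicator f) (memLp_indicator_coeFn hs f)
  rw [h] at h'
  rw [Lp.norm_def f, ← h']

/-- Extension by zero, as an isometry from `L²` of a restricted measure. -/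
def extendZero {α : Type*} [MeasurableSpace α] (μ : Measure α) {s : Set α}
    (hs : MeasurableSet s) : Lp ℂ 2 (μ.restrict s) →ₗᵢ[ℂ] Lp ℂ 2 μ where
  toFun f := (memLp_indicator_coeFn hs f).toLp
  map_add' f g := by
    rw [← MemLp.toLp_add]
    refine MemLp.toLp_congr _ _ ?_
    filter_upwards [(ae_restrict_iff' hs).1 (Lp.coeFn_add f g)] with z hz
    by_cases h : z ∈ s
    · simpa [h] using hz h
    · simp [h]
  map_smul' c f := by
    rw [RingHom.id_apply, ← MemLp.toLp_const_smul]
    refine MemLp.toLp_congr _ _ ?_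
    filter_upwards [(ae_restrict_iff' hs).1 (Lp.coeFn_smul c f)] with z hz
    by_cases h : z ∈ s
    · simpa [h] using hz h
    · simp [h]
  norm_map' f := norm_toLp_indicator hs f

theorem coeFn_extendZero {α : Type*} [MeasurableSpace α] (μ : Measure α) {s : Set α}
    (hs : MeasurableSet s) (f : Lp ℂ 2 (μ.restrict s)) :
    extendZero μ hs f =ᵐ[μ] s.indicator f :=
  MemLp.coeFn_toLp (memLp_indicator_coeFn hs f)

theorem extendZero_mulVar (μ : Measure UnitCircle) {s : Set UnitCircle} (hs : MeasurableSet s)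
    (f : Lp ℂ 2 (μ.restrict s)) :
    extendZero μ hs (mulVar _ f) = mulVar μ (extendZero μ hs f) := by
  refine Lp.ext ?_
  filter_upwards [coeFn_extendZero μ hs f, coeFn_extendZero μ hs (mulVar _ f),
    coeFn_mulVar μ (extendZero μ hs f),
    (ae_restrict_iff' hs).1 (coeFn_mulVar _ f)] with z h1 h2 h3 h4
  rw [h2, h3, h1]
  by_cases h : z ∈ s <;> simp [h, h4]

end SpectralRepresentation

/-! ### Transfer of invertibility and of the inverse bound -/

section InverseBound

variable {H K₁ K₂ K₃ : Type*}
  [NormedAddCommGroup H] [InnerProductSpace ℂ H] [CompleteSpace H]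
  [NormedAddCommGroup K₁] [InnerProductSpace ℂ K₁] [CompleteSpace K₁]
  [NormedAddCommGroup K₂] [InnerProductSpace ℂ K₂] [CompleteSpace K₂]
  [NormedAddCommGroup K₃] [InnerProductSpace ℂ K₃] [CompleteSpace K₃]

theorem coe_unitary_pow (V : unitary (K₁ →L[ℂ] K₁)) (n : ℕ) :
    (V : K₁ →L[ℂ] K₁) ^ n = (Unitary.linearIsometryEquiv (V ^ n) : K₁ →L[ℂ] K₁) := rfl

theorem isUnit_middle_of_isUnit {T : H →L[ℂ] H}
    {V₁ : unitary (K₁ →L[ℂ] K₁)} {V₃ : unitary (K₃ →L[ℂ] K₃)} {A : K₂ →L[ℂ] K₁}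
    {B : K₃ →L[ℂ] K₁} {R : K₂ →L[ℂ] K₂} {C : K₃ →L[ℂ] K₂}
    (hW : UnitarilyEquivalent T (upperTriangular (V₁ : K₁ →L[ℂ] K₁) A B R C (V₃ : K₃ →L[ℂ] K₃)))
    (hT : IsUnit T) : IsUnit R := by
  obtain ⟨W, hW⟩ := hW
  rw [ContinuousLinearMap.isUnit_iff_bijective] at hT ⊢
  refine bijective_middle_of_bijective_upperTriangular
    (V₁ := Unitary.linearIsometryEquiv V₁) (V₃ := Unitary.linearIsometryEquiv V₃)
    (A := A) (B := B) (C := C) ?_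
  have h : ⇑(upperTriangular (V₁ : K₁ →L[ℂ] K₁) A B R C (V₃ : K₃ →L[ℂ] K₃)) =
      W ∘ T ∘ W.symm := by
    ext1 x; simp [hW]
  exact h ▸ W.bijective.comp (hT.comp W.symm.bijective)

theorem iSup_enorm_inverse_pow_le {T : H →L[ℂ] H}
    {V₁ : unitary (K₁ →L[ℂ] K₁)} {V₃ : unitary (K₃ →L[ℂ] K₃)} {A : K₂ →L[ℂ] K₁}
    {B : K₃ →L[ℂ] K₁} {R : K₂ →L[ℂ] K₂} {C : K₃ →L[ℂ] K₂}
    (hW : UnitarilyEquivalent T (upperTriangular (V₁ : K₁ →L[ℂ] K₁) A B R C (V₃ : K₃ →L[ℂ] K₃)))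
    (hT : IsUnit T) :
    ⨆ n : ℕ, ‖Ring.inverse T ^ n‖ₑ ≤
      max 1 (⨆ n : ℕ, ‖Ring.inverse R ^ n‖ₑ) * (2 * (⨆ n : ℕ, ‖T ^ n‖ₑ) ^ 2 + 1) := by
  have hR := isUnit_middle_of_isUnit hW hT
  obtain ⟨W, hW⟩ := hW
  -- Nontriviality gives `‖T ^ 0‖ = 1`, hence `1 ≤ c` below.
  rcases subsingleton_or_nontrivial H with hH | hH
  · refine iSup_le fun n => ?_
    have : Ring.inverse T ^ n = 0 := by ext x; exact Subsingleton.elim _ _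
    simp [this]
  by_cases hc : ⨆ n : ℕ, ‖T ^ n‖ₑ = ⊤
  · rw [hc]
    have : max 1 (⨆ n : ℕ, ‖Ring.inverse R ^ n‖ₑ) ≠ 0 :=
      (lt_of_lt_of_le zero_lt_one (le_max_left _ _)).ne'
    simp [this]
  by_cases hs : ⨆ n : ℕ, ‖Ring.inverse R ^ n‖ₑ = ⊤
  · rw [hs]
    simp
  obtain ⟨c, hc'⟩ : ∃ c : NNReal, (c : ℝ≥0∞) = ⨆ n : ℕ, ‖T ^ n‖ₑ := ⟨_, ENNReal.coe_toNNReal hc⟩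
  obtain ⟨s, hs'⟩ : ∃ s : NNReal, (s : ℝ≥0∞) = ⨆ n : ℕ, ‖Ring.inverse R ^ n‖ₑ :=
    ⟨_, ENNReal.coe_toNNReal hs⟩
  have hTn : ∀ n : ℕ, ‖T ^ n‖ ≤ c := fun n => by
    have := le_iSup (fun n : ℕ => ‖T ^ n‖ₑ) n
    rw [← hc'] at this
    exact_mod_cast this
  have hRn : ∀ n : ℕ, ‖Ring.inverse R ^ n‖ ≤ s := fun n => by
    have := le_iSup (fun n : ℕ => ‖Ring.inverse R ^ n‖ₑ) n
    rw [← hs'] at this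
    exact_mod_cast this
  have hc1 : 1 ≤ (c : ℝ) := by simpa using hTn 0
  rw [← hc', ← hs']
  refine iSup_le fun n => ?_
  have hWn : ∀ x, W ((T ^ n) x) =
      (upperTriangular (V₁ : K₁ →L[ℂ] K₁) A B R C (V₃ : K₃ →L[ℂ] K₃) ^ n) (W x) := by
    induction n with
    | zero => simp
    | succ n ih => intro x; rw [pow_succ, pow_succ, mul_apply_eq_comp, mul_apply_eq_comp, ih, hW]
  obtain ⟨A', B', C', hn⟩ := exists_upperTriangular_pow (V₁ : K₁ →L[ℂ] K₁) A B R C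
    (V₃ : K₃ →L[ℂ] K₃) n
  rw [hn, coe_unitary_pow, coe_unitary_pow] at hWn
  -- The constant is `max 1 s` because `s = 0` when the middle space is zero.
  have hb := norm_le_of_norm_upperTriangular_le hc1 (le_max_left 1 (s : ℝ)) (c := c)
    (V₁ := Unitary.linearIsometryEquiv (V₁ ^ n)) (V₃ := Unitary.linearIsometryEquiv (V₃ ^ n))
    (A := A') (B := B') (C := C') (R := R ^ n)
    (fun z => by
      obtain ⟨x, rfl⟩ := W.surjective z
      rw [← hWn, W.norm_map, W.norm_map]
      exact (T ^ n).le_of_opNorm_le (hTn n) x)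
    (fun b => by
      have h1 : b = (Ring.inverse R ^ n) ((R ^ n) b) := by
        rw [← mul_apply_eq_comp, Ring.inverse_pow,
          Ring.inverse_mul_cancel _ (hR.pow n)]
        rfl
      calc ‖b‖ = ‖(Ring.inverse R ^ n) ((R ^ n) b)‖ := by rw [← h1]
        _ ≤ s * ‖(R ^ n) b‖ := ContinuousLinearMap.le_of_opNorm_le _ (hRn n) _
        _ ≤ max 1 (s : ℝ) * ‖(R ^ n) b‖ := by gcongr; exact le_max_right _ _)
  have hfin : ‖Ring.inverse T ^ n‖ ≤ max 1 (s : ℝ) * (2 * (c : ℝ) ^ 2 + 1) := by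
    refine ContinuousLinearMap.opNorm_le_bound _ (by positivity) fun x => ?_
    have h := hb (W ((Ring.inverse T ^ n) x))
    rw [← hWn, W.norm_map, W.norm_map, ← mul_apply_eq_comp, Ring.inverse_pow,
      Ring.mul_inverse_cancel _ (hT.pow n)] at h
    rwa [Ring.inverse_pow]
  have : ‖Ring.inverse T ^ n‖₊ ≤ max 1 s * (2 * c ^ 2 + 1) := by exact_mod_cast hfin
  rw [enorm_eq_nnnorm]
  exact_mod_cast this

end InverseBound

/-! ### Orthogonal decompositions and reducing subspaces -/

section Decomposition

variable {H L : Type*} [NormedAddCommGroup H] [InnerProductSpace ℂ H] [CompleteSpace H]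
  [NormedAddCommGroup L] [InnerProductSpace ℂ L] [CompleteSpace L]

/-- A subspace orthogonal to the range of an isometry gives a decomposition of the space into
three orthogonal summands. -/
theorem exists_isometryEquiv_triple (M : Submodule ℂ H) [CompleteSpace M] (J : L →ₗᵢ[ℂ] H)
    (hJ : ∀ b, J b ∈ Mᗮ) :
    ∃ W : H ≃ₗᵢ[ℂ] WithLp 2 (M × WithLp 2 (L × ↥(Mᗮ ⊓ (LinearMap.range J.toLinearMap)ᗮ))),
      ∀ a b c, W.symm (triple a b c) = (a : H) + J b + (c : H) := by
  set N := LinearMap.range J.toLinearMap with hN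
  let F : WithLp 2 (M × WithLp 2 (L × ↥(Mᗮ ⊓ Nᗮ))) →ₗ[ℂ] H :=
    { toFun := fun x => (x.fst : H) + J x.snd.fst + (x.snd.snd : H)
      map_add' := fun x y => by simp; abel
      map_smul' := fun c x => by simp [smul_add] }
  have hF : ∀ x, ‖F x‖ = ‖x‖ := by
    intro x
    obtain ⟨a, b, c, rfl⟩ := exists_eq_triple x
    change ‖(a : H) + J b + (c : H)‖ = _
    rw [← sq_eq_sq₀ (norm_nonneg _) (norm_nonneg _), norm_triple_sq, sq, sq, sq, sq]
    have h1 : inner ℂ ((a : H) + J b) (c : H) = 0 := by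
      rw [inner_add_left, (c.2.1 a a.2), (c.2.2 (J b) ⟨b, rfl⟩), add_zero]
    rw [norm_add_sq_eq_norm_sq_add_norm_sq_of_inner_eq_zero _ _ h1,
      norm_add_sq_eq_norm_sq_add_norm_sq_of_inner_eq_zero _ _ (hJ b a a.2), J.norm_map]
    rfl
  have hs : Function.Surjective F := by
    intro x
    have hNc : IsComplete (N : Set H) := by
      have := (J.isometry.isClosedEmbedding.isClosed_range).isComplete
      convert this using 1
      ext; simp [hN]
    have : CompleteSpace N := hNc.completeSpace_coe
    obtain ⟨a, ha, y, hy, rfl⟩ := M.exists_add_mem_mem_orthogonal x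
    obtain ⟨_, ⟨b, rfl⟩, z, hz, rfl⟩ := N.exists_add_mem_mem_orthogonal y
    have hz' : z ∈ Mᗮ := by simpa using Mᗮ.sub_mem hy (hJ b)
    exact ⟨triple ⟨a, ha⟩ b ⟨z, hz', hz⟩, by
      change a + J b + z = a + (J b + z)
      abel⟩
  exact ⟨(LinearIsometryEquiv.ofSurjective ⟨F, hF⟩ hs).symm, fun a b c => rfl⟩

/-- For `y ∈ Mᗮ` also `V y ∈ Mᗮ`, so `(y, V⁻¹ x) = (V y, x) = 0`; thus `V⁻¹ x ∈ Mᗮᗮ = M`. -/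
theorem IsReductive.symm_apply_mem {V : unitary (H →L[ℂ] H)}
    (hV : IsReductive (V : H →L[ℂ] H)) {M : Submodule ℂ H} (hM : IsClosed (M : Set H))
    (h : ∀ x ∈ M, (V : H →L[ℂ] H) x ∈ M) {x : H} (hx : x ∈ M) :
    (Unitary.linearIsometryEquiv V).symm x ∈ M := by
  have : CompleteSpace M := hM.isComplete.completeSpace_coe
  rw [← Submodule.orthogonal_orthogonal M]
  intro y hy
  have h1 := (Unitary.linearIsometryEquiv V).inner_map_map y
    ((Unitary.linearIsometryEquiv V).symm x)
  rw [LinearIsometryEquiv.apply_symm_apply] at h1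
  rw [← h1]
  exact Submodule.inner_left_of_mem_orthogonal hx (hV M hM h y hy)

/-- The restriction of a reductive unitary operator to a closed invariant subspace is unitary. -/
theorem IsReductive.exists_unitary_restrict {V : unitary (H →L[ℂ] H)}
    (hV : IsReductive (V : H →L[ℂ] H)) {M : Submodule ℂ H} [CompleteSpace M]
    (h : ∀ x ∈ M, (V : H →L[ℂ] H) x ∈ M) :
    ∃ V' : unitary (M →L[ℂ] M), ∀ x, ((V' : M →L[ℂ] M) x : H) = (V : H →L[ℂ] H) x := by
  have hM : IsClosed (M : Set H) := (completeSpace_coe_iff_isComplete.1 ‹_›).isClosed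
  let U := Unitary.linearIsometryEquiv V
  let E : M ≃ₗᵢ[ℂ] M :=
    { toFun := fun x => ⟨U x, h x x.2⟩
      invFun := fun x => ⟨U.symm x, hV.symm_apply_mem hM h x.2⟩
      map_add' := fun x y => by ext; simp
      map_smul' := fun c x => by ext; simp
      left_inv := fun x => by ext; simp
      right_inv := fun x => by ext; simp
      norm_map' := fun x => U.norm_map x }
  exact ⟨Unitary.linearIsometryEquiv.symm E, fun x => rfl⟩

end Decomposition

/-! ### Restriction of `L²` functions to a subset -/

section Restriction

variable {α : Type*} [MeasurableSpace α] {μ : Measure α} {s : Set α}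

/-- The restriction of an `L²` function to a subset. -/
def restrictLp (s : Set α) (f : Lp ℂ 2 μ) : Lp ℂ 2 (μ.restrict s) :=
  ((Lp.memLp f).restrict s).toLp

theorem coeFn_restrictLp (f : Lp ℂ 2 μ) : restrictLp s f =ᵐ[μ.restrict s] f :=
  MemLp.coeFn_toLp ((Lp.memLp f).restrict s)

/-- Restriction is the adjoint of extension by zero. -/
theorem inner_restrictLp (hs : MeasurableSet s) (f : Lp ℂ 2 μ) (b : Lp ℂ 2 (μ.restrict s)) :
    inner ℂ (restrictLp s f) b = inner ℂ f (extendZero μ hs b) := by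
  rw [L2.inner_def, L2.inner_def]
  have h1 : ∫ z, inner ℂ (f z) (extendZero μ hs b z) ∂μ =
      ∫ z, s.indicator (fun z => inner ℂ (f z) (b z)) z ∂μ := by
    refine integral_congr_ae ?_
    filter_upwards [coeFn_extendZero μ hs b] with z hz
    rw [hz]
    by_cases h : z ∈ s <;> simp [h]
  rw [h1, integral_indicator hs]
  refine integral_congr_ae ?_
  filter_upwards [coeFn_restrictLp (s := s) f] with z hz
  rw [hz]

theorem extendZero_restrictLp (hs : MeasurableSet s) (f : Lp ℂ 2 μ) (hf : ∀ z ∉ s, f z = 0) :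
    extendZero μ hs (restrictLp s f) = f := by
  refine Lp.ext ?_
  filter_upwards [coeFn_extendZero μ hs (restrictLp s f),
    (ae_restrict_iff' hs).1 (coeFn_restrictLp (s := s) f)] with z h1 h2
  rw [h1]
  by_cases h : z ∈ s
  · simp [h, h2 h]
  · simp [h, hf z h]

end Restriction

/-! ### The triangular form -/

section Model

theorem isClosed_range_linearIsometry {H L : Type*} [NormedAddCommGroup H]
    [InnerProductSpace ℂ H] [NormedAddCommGroup L] [InnerProductSpace ℂ L] [CompleteSpace L]
    (J : L →ₗᵢ[ℂ] H) : IsClosed (LinearMap.range J.toLinearMap : Set H) := by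
  have := J.isometry.isClosedEmbedding.isClosed_range
  convert this using 1
  ext; simp

/-- The block form of a rank-one perturbation of a reductive unitary operator, with respect to an
invariant subspace `N` containing `v` and a model `J : L → N` of a part of `N` which contains the
component of `u` in `N`. -/
theorem exists_unitarilyEquivalent_upperTriangular {H : Type w} {L : Type*}
    [NormedAddCommGroup H] [InnerProductSpace ℂ H] [CompleteSpace H]
    [NormedAddCommGroup L] [InnerProductSpace ℂ L] [CompleteSpace L]
    {V : unitary (H →L[ℂ] H)} (hV : IsReductive (V : H →L[ℂ] H))
    {N : Submodule ℂ H} (hNc : IsClosed (N : Set H)) (hNV : ∀ x ∈ N, (V : H →L[ℂ] H) x ∈ N)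
    {U : L →L[ℂ] L} {J : L →ₗᵢ[ℂ] H} (hJV : ∀ b, J (U b) = (V : H →L[ℂ] H) (J b))
    (hJN : ∀ b, J b ∈ N) {u v : H} {φ ψ : L} (hv : v ∈ N) (hφ : u - J φ ∈ Nᗮ)
    (hψ : ∀ b, inner ℂ v (J b) = inner ℂ ψ b) :
    ∃ (K₁ K₂ : Type w)
      (_ : NormedAddCommGroup K₁) (_ : InnerProductSpace ℂ K₁) (_ : CompleteSpace K₁)
      (_ : NormedAddCommGroup K₂) (_ : InnerProductSpace ℂ K₂) (_ : CompleteSpace K₂)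
      (V₁ : unitary (K₁ →L[ℂ] K₁)) (V₂ : unitary (K₂ →L[ℂ] K₂))
      (A : L →L[ℂ] K₁) (B : K₂ →L[ℂ] K₁) (C : K₂ →L[ℂ] L),
      UnitarilyEquivalent ((V : H →L[ℂ] H) + rankOne ℂ u v)
        (upperTriangular (V₁ : K₁ →L[ℂ] K₁) A B (U + rankOne ℂ φ ψ) C
          (V₂ : K₂ →L[ℂ] K₂)) := by
  have hM := hV N hNc hNV
  obtain ⟨W, hW⟩ := exists_isometryEquiv_triple Nᗮ J
    (fun b => N.le_orthogonal_orthogonal (hJN b))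
  have hM2 : ∀ x ∈ Nᗮᗮ ⊓ (LinearMap.range J.toLinearMap)ᗮ,
      (V : H →L[ℂ] H) x ∈ Nᗮᗮ ⊓ (LinearMap.range J.toLinearMap)ᗮ := fun x hx =>
    ⟨hV _ (Submodule.isClosed_orthogonal N) hM x hx.1,
      hV _ (isClosed_range_linearIsometry J) (by rintro _ ⟨f, rfl⟩; exact ⟨_, hJV f⟩) x hx.2⟩
  have hM2c : IsClosed ((Nᗮᗮ ⊓ (LinearMap.range J.toLinearMap)ᗮ : Submodule ℂ H) : Set H) :=
    (Submodule.isClosed_orthogonal _).inter (Submodule.isClosed_orthogonal _)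
  have : CompleteSpace (Nᗮᗮ ⊓ (LinearMap.range J.toLinearMap)ᗮ : Submodule ℂ H) :=
    hM2c.isComplete.completeSpace_coe
  generalize Nᗮᗮ ⊓ (LinearMap.range J.toLinearMap)ᗮ = P at *
  obtain ⟨V₁, hV₁⟩ := hV.exists_unitary_restrict hM
  obtain ⟨V₂, hV₂⟩ := hV.exists_unitary_restrict hM2
  -- `u` splits into `u₁ ∈ Nᗮ` and `J φ`, with nothing in `P`: the rank-one term has no third row.
  let u₁ : Nᗮ := ⟨u - J φ, hφ⟩
  have hu : u = (u₁ : H) + J φ := by simp [u₁]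
  let ℓ : P →L[ℂ] ℂ := innerSL ℂ v ∘L P.subtypeL
  refine ⟨Nᗮ, P, inferInstance, inferInstance, inferInstance, inferInstance, inferInstance,
    inferInstance, V₁, V₂, rankOne ℂ u₁ ψ, ℓ.smulRight u₁, ℓ.smulRight φ, W, fun x => ?_⟩
  obtain ⟨y, rfl⟩ := W.symm.surjective x
  obtain ⟨a, b, c, rfl⟩ := exists_eq_triple y
  rw [LinearIsometryEquiv.apply_symm_apply, ← LinearIsometryEquiv.eq_symm_apply]
  -- This removes the first column of the rank-one term.
  have ha : inner ℂ v (a : H) = 0 := a.2 v hv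
  have hc : ℓ c = inner ℂ v (c : H) := rfl
  rw [upperTriangular_triple, hW, hW]
  simp only [add_apply, rankOne_apply, map_add, hJV, ContinuousLinearMap.smulRight_apply,
    ha, hψ, hc, Submodule.coe_add, Submodule.coe_smul, hV₁, hV₂, map_smul]
  rw [hu]
  module

end Model

end RankOnePerturbation

end

/-! ### Choice of the measure and of the two functions -/

theorem theorem7p11 {H : Type w} [NormedAddCommGroup H] [InnerProductSpace ℂ H]
    [CompleteSpace H] (V : unitary (H →L[ℂ] H)) (hV : IsReductive (V : H →L[ℂ] H))
    (u v : H) (T : H →L[ℂ] H) (hT : T = V + rankOne ℂ u v) :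
    ∃ (ν : Measure UnitCircle) (φ ψ : Lp ℂ 2 ν) (T₁ : Lp ℂ 2 ν →L[ℂ] Lp ℂ 2 ν),
      IsFiniteMeasure ν ∧
      AbsolutelyContinuousSpectral ν V ∧
      (∀ᵐ z ∂ν, φ z ≠ 0) ∧
      (∀ᵐ z ∂ν, ψ z ≠ 0) ∧
      T₁ = mulVar ν + rankOne ℂ φ ψ ∧
      (∃ (K₁ K₂ : Type w)
        (_ : NormedAddCommGroup K₁) (_ : InnerProductSpace ℂ K₁) (_ : CompleteSpace K₁)
        (_ : NormedAddCommGroup K₂) (_ : InnerProductSpace ℂ K₂) (_ : CompleteSpace K₂)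
        (V₁ : unitary (K₁ →L[ℂ] K₁)) (V₂ : unitary (K₂ →L[ℂ] K₂))
        (A : Lp ℂ 2 ν →L[ℂ] K₁) (B : K₂ →L[ℂ] K₁) (C : K₂ →L[ℂ] Lp ℂ 2 ν),
        UnitarilyEquivalent T
          (upperTriangular (V₁ : K₁ →L[ℂ] K₁) A B T₁ C (V₂ : K₂ →L[ℂ] K₂))) ∧
      (IsUnit T →
        IsUnit T₁ ∧
        ⨆ n : ℕ, ‖Ring.inverse T ^ n‖ₑ ≤
          max 1 (⨆ n : ℕ, ‖Ring.inverse T₁ ^ n‖ₑ) * (2 * (⨆ n : ℕ, ‖T ^ n‖ₑ) ^ 2 + 1)) := by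
  -- Only these properties of the spectral measure at `v` are used; `e` is the constant function
  -- `1`.
  obtain ⟨μ, _, hac, J, hJV, e, he, he'⟩ : ∃ μ : Measure UnitCircle, IsFiniteMeasure μ ∧
      (∀ B, (∀ x : H, spectralMeasureAt V x B = 0) → μ B = 0) ∧
      ∃ J : Lp ℂ 2 μ →ₗᵢ[ℂ] H, (∀ f, J (mulVar μ f) = (V : H →L[ℂ] H) (J f)) ∧
        ∃ e, J e = v ∧ ∀ᵐ z ∂μ, e z ≠ 0 := by
    obtain ⟨J, hJV, hJ1⟩ := exists_isometry_spectralMeasureAt V v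
    refine ⟨spectralMeasureAt V v, inferInstance, fun B h => h v, J, hJV, _, hJ1, ?_⟩
    filter_upwards [ContinuousMap.coeFn_toLp (p := 2) (𝕜 := ℂ) (spectralMeasureAt V v)
      (1 : C(UnitCircle, ℂ))] with z hz
    rw [hz]; simp
  -- With `g = J* u`, the vector `J g` is the projection of `u` onto the range of `J`.
  obtain ⟨g, hg⟩ : ∃ g, ∀ f, inner ℂ (J f) (u - J g) = 0 :=
    ⟨ContinuousLinearMap.adjoint J.toContinuousLinearMap u, fun f => by
      rw [inner_sub_right, J.inner_map_map, sub_eq_zero]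
      exact (ContinuousLinearMap.adjoint_inner_right J.toContinuousLinearMap f u).symm⟩
  -- Cutting down to `s` makes `φ` nonvanishing; functions living off `s` go to the last summand.
  let s : Set UnitCircle := {z | g z ≠ 0}
  have hs : MeasurableSet s :=
    (Lp.stronglyMeasurable g).measurable (measurableSet_singleton 0).compl
  have hequiv := exists_unitarilyEquivalent_upperTriangular hV
    (N := LinearMap.range J.toLinearMap) (isClosed_range_linearIsometry J)
    (by rintro _ ⟨f, rfl⟩; exact ⟨_, hJV f⟩)
    (U := mulVar (μ.restrict s)) (J := J.comp (extendZero μ hs))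
    (fun b => by
      rw [LinearIsometry.coe_comp, Function.comp_apply, Function.comp_apply, extendZero_mulVar,
        hJV])
    (fun b => ⟨_, rfl⟩) (u := u) (v := v) (φ := restrictLp s g) (ψ := restrictLp s e) ⟨e, he⟩
    (by
      rw [LinearIsometry.coe_comp, Function.comp_apply,
        extendZero_restrictLp hs g fun z hz => by simpa [s] using hz]
      rintro _ ⟨f, rfl⟩
      exact hg f)
    (fun b => by
      rw [LinearIsometry.coe_comp, Function.comp_apply, inner_restrictLp hs, ← he, J.inner_map_map])
  rw [← hT] at hequiv
  refine ⟨μ.restrict s, restrictLp s g, restrictLp s e, _, inferInstance, ?_, ?_, ?_, rfl,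
    hequiv, ?_⟩
  · intro B _ h
    exact Measure.restrict_le_self.absolutelyContinuous (hac B h)
  · filter_upwards [coeFn_restrictLp (s := s) g, ae_restrict_mem hs] with z hz hzs
    rw [hz]; exact hzs
  · filter_upwards [coeFn_restrictLp (s := s) e, ae_restrict_of_ae he'] with z h1 h2
    rw [h1]; exact h2
  · intro hU
    obtain ⟨K₁, K₂, _, _, _, _, _, _, V₁, V₂, A, B, C, h⟩ := hequiv
    exact ⟨isUnit_middle_of_isUnit h hU, iSup_enorm_inverse_pow_le h hU⟩
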